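/- Let $K$ be a field that is algebraic over $\mathbb{Q}$, with algebraic closure $\overline{K}$. Let $\mathcal{M}_K$ be the commutative ring whose elements are the rational functions $f/g\in K(x)$ with $f,g\in K[x]$ monic, whose addition is multiplication of rational functions, and whose multiplication is the biadditive extension of $$\Big[\prod_i (x-\alpha_i)\Big]\cdot\Big[\prod_j (x-\beta_j)\Big]=\Big[\prod_{i,j}(x-\alpha_i\beta_j)\Big]$$ (roots $\alpha_i,\beta_j\in\overline{K}$ counted with multiplicity); its unit element is $[x-1]$. For $n\ge 0$ let $t_n:\mathcal{M}_K\to K$ be the additive map with $t_n\big(\big[\prod_i(x-\alpha_i)\big]\big)=\sum_i\alpha_i^n$ (with $0^0=1$), and give $\mathcal{M}_K$ the topology induced by the injection $(t_n)_{n\ge 0}:\mathcal{M}_K\to\prod_{n\ge 0}K$, where $K$ is discrete and the product carries the product topology. Theorem. Let $\phi:\mathcal{M}_K\to\mathcal{M}_K$ be a continuous (unital) ring endomorphism. Then at least one of the following holds. 1. There exist integers $k,s\ge 0$ and $\sigma\in\mathrm{Gal}(K/\mathbb{Q})$ (the group of field automorphisms of $K$) such that for every monic polynomial $f=\prod_i(x-\alpha_i)\in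 K[x]$ (with $\alpha_i\in\overline{K}$) the sum $\sum_i(\alpha_i^s-1)$ is an integer and $$\phi\Big(\prod_i(x-\alpha_i)\Big)=x^{\sum_i(\alpha_i^s-1)}\cdot\prod_i\big(x-\sigma(\alpha_i)^k\big),$$ where $\sigma$ is extended to an automorphism of $\overline{K}$ (the right-hand side does not depend on the extension), and $0^0=1$. 2. Every root (zero or pole in $\overline{K}$) of every rational function in the image of $\phi$ is a root of unity. Moreover, if $K/\mathbb{Q}$ is finite, there is an integer $N\ge 1$ such that all these roots, for all elements of the image of $\phi$, are $N$-th roots of unity. -/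

import Mathlib

open Polynomial

/-- The underlying set of `𝓜_K`: the rational functions over `K` which are ratios of two monic
polynomials. -/
@[ext]
structure MonicRatio (K : Type*) [Field K] where
  /-- the underlying rational function -/
  val : RatFunc K
  /-- it is a ratio of monic polynomials -/
  isRatio : ∃ f g : K[X], f.Monic ∧ g.Monic ∧
    val = algebraMap K[X] (RatFunc K) f / algebraMap K[X] (RatFunc K) g

namespace MonicRatio

section Basic

variable {K : Type*} [Field K]

/-- The ratio `f / g` of two monic polynomials. -/
noncomputable def mkRatio (f g : K[X]) (hf : f.Monic) (hg : g.Monic) : MonicRatio K :=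
  ⟨algebraMap K[X] (RatFunc K) f / algebraMap K[X] (RatFunc K) g, f, g, hf, hg, rfl⟩

/-- The class `[f]` of a monic polynomial `f`. -/
noncomputable def ofPoly (f : K[X]) (hf : f.Monic) : MonicRatio K :=
  mkRatio f 1 hf monic_one

/-- The formal sum `∑ᵢ [αᵢ]` of the roots, with multiplicity, of `f` in an algebraic closure, as an
element of the monoid ring `ℤ[(K̄, ·)]`, in which `[α] * [β] = [α * β]`. -/
noncomputable def rootSum (f : K[X]) : MonoidAlgebra ℤ (AlgebraicClosure K) :=
  ((f.aroots (AlgebraicClosure K)).map fun α => MonoidAlgebra.single α 1).sum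

/-- The divisor of zeros minus poles of a rational function in `𝓜_K`. -/
noncomputable def divisor (r : MonicRatio K) : MonoidAlgebra ℤ (AlgebraicClosure K) :=
  rootSum r.val.num - rootSum r.val.denom

/-- `α` (in the algebraic closure) is a root of `r`: a zero of its numerator or of its denominator
in lowest terms. -/
def IsRootOf (r : MonicRatio K) (α : AlgebraicClosure K) : Prop :=
  aeval α r.val.num = 0 ∨ aeval α r.val.denom = 0

/-- The map `t_n`, additive with `t_n [x - α] = α ^ n` (where `0 ^ 0 = 1`). Its values lie in `K`;
they are recorded in the algebraic closure of `K`. -/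
noncomputable def powerSum (n : ℕ) (r : MonicRatio K) : AlgebraicClosure K :=
  ((r.val.num.aroots (AlgebraicClosure K)).map fun α => α ^ n).sum -
    ((r.val.denom.aroots (AlgebraicClosure K)).map fun α => α ^ n).sum

/-- The topology of `𝓜_K`: the one induced by `r ↦ (t_0 r, t_1 r, t_2 r, …)` from the product of
countably many copies of the field with its discrete topology `⊥`. -/
noncomputable instance : TopologicalSpace (MonicRatio K) :=
  TopologicalSpace.induced (fun r (n : ℕ) => powerSum n r)
    (@Pi.topologicalSpace ℕ (fun _ => AlgebraicClosure K) fun _ => ⊥)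

theorem rootSum_mul {f g : K[X]} (hf : f ≠ 0) (hg : g ≠ 0) :
    rootSum (f * g) = rootSum f + rootSum g := by
  unfold rootSum
  rw [aroots_mul (mul_ne_zero hf hg), Multiset.map_add, Multiset.sum_add]

theorem sum_single_apply {M : Type*} [DecidableEq M] (s : Multiset M) (a : M) :
    ((s.map fun α => (MonoidAlgebra.single α 1 : MonoidAlgebra ℤ M)).sum).coeff a = s.count a := by
  induction s using Multiset.induction_on with
  | empty => simp
  | cons b s ih =>
    rw [Multiset.map_cons, Multiset.sum_cons, MonoidAlgebra.coeff_add, Finsupp.add_apply, ih,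
      Multiset.count_cons]
    by_cases h : a = b
    · subst h; simp [add_comm]
    · simp [h]

theorem rootSum_injective {f g : K[X]} (hf : f.Monic) (hg : g.Monic)
    (h : rootSum f = rootSum g) : f = g := by
  classical
  have hr : f.aroots (AlgebraicClosure K) = g.aroots (AlgebraicClosure K) := by
    ext a
    have := congrArg (fun q => q.coeff a) h
    simp only [rootSum, sum_single_apply] at this
    exact_mod_cast this
  apply Polynomial.map_injective _ (algebraMap K (AlgebraicClosure K)).injective
  rw [(IsAlgClosed.splits (f.map (algebraMap K (AlgebraicClosure K)))).eq_prod_roots_of_monic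
      (hf.map _),
    (IsAlgClosed.splits (g.map (algebraMap K (AlgebraicClosure K)))).eq_prod_roots_of_monic
      (hg.map _)]
  rw [aroots_def, aroots_def] at hr
  rw [hr]

theorem divisor_eq {r : MonicRatio K} {f g : K[X]} (hf : f ≠ 0) (hg : g ≠ 0)
    (h : r.val = algebraMap K[X] (RatFunc K) f / algebraMap K[X] (RatFunc K) g) :
    divisor r = rootSum f - rootSum g := by
  have hd := r.val.denom_ne_zero
  have hd' := RatFunc.algebraMap_ne_zero hd
  have hg' := RatFunc.algebraMap_ne_zero hg
  have key : r.val.num * g = f * r.val.denom := by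
    apply RatFunc.algebraMap_injective K
    rw [map_mul, map_mul]
    have h1 := RatFunc.num_div_denom r.val
    rw [← div_eq_div_iff hd' hg', h1, h]
  have hn : r.val.num ≠ 0 := by
    intro h0
    rw [h0, zero_mul] at key
    exact mul_ne_zero hf hd key.symm
  have := congrArg rootSum key
  rw [rootSum_mul hn hg, rootSum_mul hf hd] at this
  unfold divisor
  rw [sub_eq_sub_iff_add_eq_add, this]

theorem divisor_injective : Function.Injective (divisor (K := K)) := by
  intro r s h
  obtain ⟨f, g, hf, hg, hr⟩ := r.isRatio
  obtain ⟨f', g', hf', hg', hs⟩ := s.isRatio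
  rw [divisor_eq hf.ne_zero hg.ne_zero hr, divisor_eq hf'.ne_zero hg'.ne_zero hs,
    sub_eq_sub_iff_add_eq_add, ← rootSum_mul hf.ne_zero hg'.ne_zero,
    ← rootSum_mul hf'.ne_zero hg.ne_zero] at h
  have := rootSum_injective (hf.mul hg') (hf'.mul hg) h
  ext1
  rw [hr, hs, div_eq_div_iff (RatFunc.algebraMap_ne_zero hg.ne_zero)
    (RatFunc.algebraMap_ne_zero hg'.ne_zero), ← map_mul, ← map_mul, this]

/-- Addition in `𝓜_K` is multiplication of rational functions. -/
noncomputable instance : Add (MonicRatio K) :=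
  ⟨fun r s => ⟨r.val * s.val, by
    obtain ⟨f, g, hf, hg, hr⟩ := r.isRatio
    obtain ⟨f', g', hf', hg', hs⟩ := s.isRatio
    exact ⟨f * f', g * g', hf.mul hf', hg.mul hg', by
      rw [hr, hs, map_mul, map_mul, div_mul_div_comm]⟩⟩⟩

/-- The zero of `𝓜_K` is the rational function `1`. -/
noncomputable instance : Zero (MonicRatio K) := ⟨ofPoly 1 monic_one⟩

/-- Negation in `𝓜_K` is inversion of rational functions. -/
noncomputable instance : Neg (MonicRatio K) :=
  ⟨fun r => ⟨r.val⁻¹, by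
    obtain ⟨f, g, hf, hg, hr⟩ := r.isRatio
    exact ⟨g, f, hg, hf, by rw [hr, inv_div]⟩⟩⟩

/-- The one of `𝓜_K` is `[x - 1]`. -/
noncomputable instance : One (MonicRatio K) := ⟨ofPoly (X - C 1) (monic_X_sub_C 1)⟩

theorem val_add (r s : MonicRatio K) : (r + s).val = r.val * s.val := rfl

theorem val_zero : (0 : MonicRatio K).val = 1 := by
  change algebraMap K[X] (RatFunc K) 1 / algebraMap K[X] (RatFunc K) 1 = 1
  simp

theorem val_neg (r : MonicRatio K) : (-r).val = r.val⁻¹ := rfl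

theorem val_ne_zero (r : MonicRatio K) : r.val ≠ 0 := by
  obtain ⟨f, g, hf, hg, hr⟩ := r.isRatio
  rw [hr]
  exact div_ne_zero (RatFunc.algebraMap_ne_zero hf.ne_zero)
    (RatFunc.algebraMap_ne_zero hg.ne_zero)

theorem divisor_mkRatio (f g : K[X]) (hf : f.Monic) (hg : g.Monic) :
    divisor (mkRatio f g hf hg) = rootSum f - rootSum g :=
  divisor_eq hf.ne_zero hg.ne_zero rfl

theorem rootSum_one : rootSum (1 : K[X]) = 0 := by
  simp [rootSum]

theorem divisor_ofPoly (f : K[X]) (hf : f.Monic) : divisor (ofPoly f hf) = rootSum f := by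
  rw [ofPoly, divisor_mkRatio, rootSum_one, sub_zero]

theorem divisor_one : divisor (1 : MonicRatio K) = 1 := by
  change divisor (ofPoly (X - C 1) (monic_X_sub_C 1)) = 1
  rw [divisor_ofPoly, rootSum, aroots_X_sub_C]
  simp [MonoidAlgebra.one_def]

theorem divisor_add (r s : MonicRatio K) : divisor (r + s) = divisor r + divisor s := by
  obtain ⟨f, g, hf, hg, hr⟩ := r.isRatio
  obtain ⟨f', g', hf', hg', hs⟩ := s.isRatio
  rw [divisor_eq (r := r + s) (hf.mul hf').ne_zero (hg.mul hg').ne_zero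
      (by rw [val_add, hr, hs, map_mul, map_mul, div_mul_div_comm]),
    divisor_eq hf.ne_zero hg.ne_zero hr, divisor_eq hf'.ne_zero hg'.ne_zero hs,
    rootSum_mul hf.ne_zero hf'.ne_zero, rootSum_mul hg.ne_zero hg'.ne_zero]
  abel

theorem rootSum_tensor {f g h : K[X]} (hh : h.map (algebraMap K (AlgebraicClosure K)) =
    ((f.aroots (AlgebraicClosure K) ×ˢ g.aroots (AlgebraicClosure K)).map
      fun p => X - C (p.1 * p.2)).prod) : rootSum h = rootSum f * rootSum g := by
  have hr : h.aroots (AlgebraicClosure K) =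
      (f.aroots (AlgebraicClosure K) ×ˢ g.aroots (AlgebraicClosure K)).map
        fun p => p.1 * p.2 := by
    have h1 := Polynomial.roots_multiset_prod_X_sub_C
      ((f.aroots (AlgebraicClosure K) ×ˢ g.aroots (AlgebraicClosure K)).map fun p => p.1 * p.2)
    rw [Multiset.map_map] at h1
    rw [aroots_def, hh]
    exact h1
  rw [rootSum, hr, rootSum, rootSum, Multiset.map_map]
  simp only [SProd.sprod, Multiset.product, Multiset.map_bind, Multiset.sum_bind, Multiset.map_map,
    Function.comp_def]
  rw [← Multiset.sum_map_mul_right]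
  congr 1
  apply Multiset.map_congr rfl
  intro a _
  rw [← Multiset.sum_map_mul_left]
  simp [MonoidAlgebra.single_mul_single]

end Basic

section Ring

variable {K : Type*} [Field K] [CharZero K]

/-- For monic `f = ∏ᵢ (x - αᵢ)` and `g = ∏ⱼ (x - βⱼ)` over `K`, the polynomial
`∏ᵢⱼ (x - αᵢ βⱼ)` has coefficients in `K`. -/
theorem exists_tensor (f g : K[X]) : ∃ h : K[X], h.Monic ∧
    h.map (algebraMap K (AlgebraicClosure K)) =
      ((f.aroots (AlgebraicClosure K) ×ˢ g.aroots (AlgebraicClosure K)).map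
        fun p => X - C (p.1 * p.2)).prod := by
  let L := AlgebraicClosure K
  set H : L[X] := ((f.aroots L ×ˢ g.aroots L).map fun p => X - C (p.1 * p.2)).prod with hH
  have hmonic : H.Monic := monic_multiset_prod_of_monic _ _ fun p _ => monic_X_sub_C _
  have hinv (q : K[X]) (τ : L ≃ₐ[K] L) : (q.aroots L).map τ = q.aroots L := by
    have h1 : (q.map (algebraMap K L)).roots.map (τ : L →+* L) =
        ((q.map (algebraMap K L)).map (τ : L →+* L)).roots :=
      (Polynomial.Splits.roots_map (IsAlgClosed.splits _) _).symm
    rw [Polynomial.map_map] at h1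
    have h2 : (τ : L →+* L).comp (algebraMap K L) = algebraMap K L := by
      ext a; simp
    rw [h2] at h1
    exact h1
  have hfix (τ : L ≃ₐ[K] L) : H.map (τ : L →+* L) = H := by
    rw [hH, Polynomial.map_multiset_prod, Multiset.map_map]
    have : (fun p : L × L => X - C (p.1 * p.2)) ∘ (Prod.map τ τ) =
        (Polynomial.map (τ : L →+* L)) ∘ fun p : L × L => X - C (p.1 * p.2) := by
      ext1 p; simp
    rw [← this, ← Multiset.map_map]
    congr 2
    conv_rhs => rw [← hinv f τ, ← hinv g τ]
    simp only [SProd.sprod, Multiset.product, Multiset.map_bind, Multiset.bind_map,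
      Multiset.map_map]
    rfl
  have hlift : H ∈ Polynomial.lifts (algebraMap K L) := by
    rw [Polynomial.lifts_iff_coeff_lifts]
    intro n
    have := (InfiniteGalois.mem_range_algebraMap_iff_fixed (k := K) (K := L) (H.coeff n)).2
      fun τ => by
        conv_rhs => rw [← hfix τ]
        rw [coeff_map]; rfl
    exact this
  obtain ⟨h, hh, -, hm⟩ := lifts_and_natDegree_eq_and_monic hlift hmonic
  exact ⟨h, hm, hh⟩

theorem exists_rootSum_mul (f g : K[X]) :
    ∃ h : K[X], h.Monic ∧ rootSum h = rootSum f * rootSum g := by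
  obtain ⟨h, hm, hh⟩ := exists_tensor f g
  exact ⟨h, hm, rootSum_tensor hh⟩

theorem exists_mul (r s : MonicRatio K) :
    ∃ p : MonicRatio K, divisor p = divisor r * divisor s := by
  obtain ⟨f, g, hf, hg, hr⟩ := r.isRatio
  obtain ⟨f', g', hf', hg', hs⟩ := s.isRatio
  obtain ⟨a, ha, ha'⟩ := exists_rootSum_mul f f'
  obtain ⟨b, hb, hb'⟩ := exists_rootSum_mul g g'
  obtain ⟨c, hc, hc'⟩ := exists_rootSum_mul f g'
  obtain ⟨d, hd, hd'⟩ := exists_rootSum_mul g f'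
  refine ⟨mkRatio (a * b) (c * d) (ha.mul hb) (hc.mul hd), ?_⟩
  rw [divisor_mkRatio, rootSum_mul ha.ne_zero hb.ne_zero, rootSum_mul hc.ne_zero hd.ne_zero,
    ha', hb', hc', hd', divisor_eq hf.ne_zero hg.ne_zero hr,
    divisor_eq hf'.ne_zero hg'.ne_zero hs]
  ring

/-- The product `r * s` in `𝓜_K`: the unique element whose divisor is the product of the divisors
in `ℤ[(K̄, ·)]`, that is, the biadditive extension of
`[∏ᵢ (x - αᵢ)] * [∏ⱼ (x - βⱼ)] = [∏ᵢⱼ (x - αᵢ βⱼ)]`. -/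
noncomputable instance : Mul (MonicRatio K) := ⟨fun r s => (exists_mul r s).choose⟩

theorem divisor_mul (r s : MonicRatio K) : divisor (r * s) = divisor r * divisor s :=
  (exists_mul r s).choose_spec

/-- The product of the classes of two monic polynomials `∏ᵢ (x - αᵢ)` and `∏ⱼ (x - βⱼ)` is the class
of `∏ᵢⱼ (x - αᵢ βⱼ)`. -/
theorem ofPoly_mul {f g h : K[X]} (hf : f.Monic) (hg : g.Monic) (hm : h.Monic)
    (hh : h.map (algebraMap K (AlgebraicClosure K)) =
      ((f.aroots (AlgebraicClosure K) ×ˢ g.aroots (AlgebraicClosure K)).map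
        fun p => X - C (p.1 * p.2)).prod) :
    ofPoly f hf * ofPoly g hg = ofPoly h hm :=
  divisor_injective (by
    rw [divisor_mul, divisor_ofPoly, divisor_ofPoly, divisor_ofPoly, rootSum_tensor hh])

/-- The commutative ring `𝓜_K`. -/
noncomputable instance : CommRing (MonicRatio K) where
  add_assoc r s t := by ext1; simp only [val_add, mul_assoc]
  zero_add r := by ext1; rw [val_add, val_zero, one_mul]
  add_zero r := by ext1; rw [val_add, val_zero, mul_one]
  add_comm r s := by ext1; rw [val_add, val_add, mul_comm]
  neg_add_cancel r := by
    ext1; rw [val_add, val_neg, val_zero, inv_mul_cancel₀ (val_ne_zero r)]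
  nsmul := nsmulRec
  zsmul := zsmulRec
  mul_assoc r s t := divisor_injective (by simp only [divisor_mul, mul_assoc])
  mul_comm r s := divisor_injective (by rw [divisor_mul, divisor_mul, mul_comm])
  one_mul r := divisor_injective (by rw [divisor_mul, divisor_one, one_mul])
  mul_one r := divisor_injective (by rw [divisor_mul, divisor_one, mul_one])
  left_distrib r s t := divisor_injective (by simp only [divisor_mul, divisor_add, mul_add])
  right_distrib r s t := divisor_injective (by simp only [divisor_mul, divisor_add, add_mul])
  zero_mul r := divisor_injective (by
    have h0 : divisor (0 : MonicRatio K) = 0 := (divisor_ofPoly 1 monic_one).trans rootSum_one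
    rw [divisor_mul, h0, zero_mul])
  mul_zero r := divisor_injective (by
    have h0 : divisor (0 : MonicRatio K) = 0 := (divisor_ofPoly 1 monic_one).trans rootSum_one
    rw [divisor_mul, h0, mul_zero])

end Ring

end MonicRatio

/-!
Write `L` for the algebraic closure of `K`, and view `𝓜_K` inside the monoid ring `ℤ[(L, ·)]`
through divisors, so that `t_n` is induced by `[a] ↦ a ^ n`. The first alternative always holds,
with `s = 0`: there are `k ≥ 0` and `σ` with `t_n ∘ φ = σ ∘ t_{kn}` for all `n`
(`exists_powerSumHom_comp_eq_mul`). As an element of `ℤ[(L, ·)]` is determined by its power sums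
(`eq_of_evalPow_eq`), this gives `φ [∏ (x - αᵢ)] = [∏ (x - σ(αᵢ) ^ k)]`.

Continuity says that the kernel of `t_n ∘ φ`, a prime ideal, contains the intersection of finitely
many of the kernels of the `t_i`, hence one of them. Since `t_i` is onto `K` for `i > 0` and `t_0`
is integral, `t_n ∘ φ = σ_n ∘ t_{k_n}` for some `k_n` and some field embedding `σ_n`
(`exists_powerSumHom_comp_eq`), and `k_0 = 0`.

That `k_n` is linear in `n` and `σ_n` constant follows from the shape of the units of `ℤ[(L, ·)]`.
Apart from `[0]`, a unit is supported on a single class of `Lˣ` modulo roots of unity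
(`exists_isIsotypic_of_mul_eq_one`): applying `[a] ↦ a ^ n` on coefficients, it becomes a unit of
the group algebra over `L` of a torsion-free group, that is, a monomial, and its degree does not
depend on `n` because averages over `n` of power sums of roots of unity with integral multiplicities
are integers. Hence the `n`-th power sum of a unit is the `n`-th power of its first power sum up to
an integral unit (`isIntegral_evalPow_mul_of_mul_eq_one`). For `φ [x - a]`, `a ≠ 0`, this compares
`σ_n(a) ^ {k_n}` with `σ_1(a) ^ {n k_1}`. The case `a = 2` yields `k_n = n k_1`; if `k_1 > 0`, then
`σ_n(a) / σ_1(a)` is integral for all `a ≠ 0`, which forces `σ_n = σ_1`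
(`ringHom_eq_of_isIntegral_div`).
-/

/-! ### Units of group algebras of torsion-free abelian groups -/

/-- Every torsion-free abelian group has the two-unique-products property: the finitely many
elements involved generate a finitely generated subgroup, which embeds into some `ℤ ^ r`. -/
theorem CommGroup.twoUniqueProds_of_isMulTorsionFree (G : Type*) [CommGroup G]
    [IsMulTorsionFree G] : TwoUniqueProds G where
  uniqueMul_of_one_lt_card {A B} hAB := by
    classical
    let H : Subgroup G := Subgroup.closure ((A ∪ B : Finset G) : Set G)
    have : Group.FG H := Group.closure_finset_fg _
    have : Monoid.FG H := Group.fg_iff_monoid_fg.1 this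
    have : IsMulTorsionFree H := H.subtype_injective.isMulTorsionFree
    have key : ∀ S : Finset G, S ⊆ A ∪ B →
        (S.subtype (· ∈ H)).map (Function.Embedding.subtype _) = S := fun S hS =>
      Finset.subtype_map_of_mem fun x hx => Subgroup.subset_closure (Finset.mem_coe.2 (hS hx))
    have hA := key A Finset.subset_union_left
    have hB := key B Finset.subset_union_right
    rw [← hA, ← hB, Finset.card_map, Finset.card_map] at hAB
    obtain ⟨p, hp, q, hq, hne, hup, huq⟩ := TwoUniqueProds.uniqueMul_of_one_lt_card hAB
    have himg : ∀ p ∈ (A.subtype (· ∈ H)) ×ˢ (B.subtype (· ∈ H)),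
        ((p.1 : G), (p.2 : G)) ∈ A ×ˢ B := fun p hp => by simpa using hp
    have huniq : ∀ p : H × H, UniqueMul (A.subtype (· ∈ H)) (B.subtype (· ∈ H)) p.1 p.2 →
        UniqueMul A B (p.1 : G) (p.2 : G) := fun p h => by
      rw [← hA, ← hB]
      exact (UniqueMul.mulHom_map_iff (Function.Embedding.subtype (· ∈ H))
        (fun _ _ => rfl)).2 h
    refine ⟨_, himg p hp, _, himg q hq, fun h => hne ?_, huniq p hup, huniq q huq⟩
    simpa [Prod.ext_iff] using h

/-- Over a domain, a pair of mutually inverse elements of the group algebra of a group with the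
two-unique-products property is a pair of monomials. -/
theorem MonoidAlgebra.exists_eq_single_of_mul_eq_one {R G : Type*} [CommRing R] [IsDomain R]
    [Group G] [TwoUniqueProds G] {x y : MonoidAlgebra R G} (h : x * y = 1) :
    ∃ (g : G) (c d : R), c * d = 1 ∧ x = single g c ∧ y = single g⁻¹ d := by
  classical
  have hx : x.coeff.support.Nonempty := by
    rw [Finsupp.support_nonempty_iff, Ne, coeff_eq_zero]
    rintro rfl
    exact zero_ne_one ((zero_mul y).symm.trans h)
  have hy : y.coeff.support.Nonempty := by
    rw [Finsupp.support_nonempty_iff, Ne, coeff_eq_zero]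
    rintro rfl
    exact zero_ne_one ((mul_zero x).symm.trans h)
  have hcard : x.coeff.support.card * y.coeff.support.card ≤ 1 := by
    by_contra! hlt
    obtain ⟨p, hp, q, hq, hne, hup, huq⟩ := TwoUniqueProds.uniqueMul_of_one_lt_card hlt
    have key : ∀ p ∈ x.coeff.support ×ˢ y.coeff.support,
        UniqueMul x.coeff.support y.coeff.support p.1 p.2 → p.1 * p.2 = 1 := by
      intro p hp hup
      have h1 := coeff_mul_mul_of_uniqueMul hup
      rw [Finset.mem_product, Finsupp.mem_support_iff, Finsupp.mem_support_iff] at hp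
      by_contra hne
      rw [h, one_def, coeff_single, Finsupp.single_eq_of_ne hne] at h1
      exact mul_ne_zero hp.1 hp.2 h1.symm
    obtain ⟨h1, h2⟩ := Finset.mem_product.1 hp
    have := huq h1 h2 ((key p hp hup).trans (key q hq huq).symm)
    exact hne (Prod.ext this.1 this.2)
  have hx1 := hx.card_pos
  have hy1 := hy.card_pos
  obtain ⟨g, c, -, hxg⟩ := Finsupp.card_support_eq_one'.1
    (show x.coeff.support.card = 1 by nlinarith)
  obtain ⟨g', d, -, hyg⟩ := Finsupp.card_support_eq_one'.1
    (show y.coeff.support.card = 1 by nlinarith)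
  have hx' : x = single g c := coeff_injective (hxg.trans (coeff_single g c).symm)
  have hy' : y = single g' d := coeff_injective (hyg.trans (coeff_single g' d).symm)
  rw [hx', hy', single_mul_single, one_def, single_inj] at h
  obtain ⟨h1, h2⟩ : g * g' = 1 ∧ c * d = 1 := by simpa using h
  exact ⟨g, c, d, h2, hx', by rw [hy', eq_inv_of_mul_eq_one_right h1]⟩

namespace MonicRatio

/-! ### Power sums of units of the integral monoid ring of a field -/

section PowerSums

variable {L : Type*} [Field L]

/-- The ring homomorphism `ℤ[(L, ·)] → L` with `[a] ↦ a ^ n`. -/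
noncomputable def evalPow (L : Type*) [Field L] (n : ℕ) : MonoidAlgebra ℤ L →+* L :=
  (MonoidAlgebra.lift ℤ L L (powMonoidHom n)).toRingHom

theorem evalPow_single (n : ℕ) (a : L) (r : ℤ) :
    evalPow L n (MonoidAlgebra.single a r) = r * a ^ n := by
  simp [evalPow, MonoidAlgebra.lift_apply']

theorem evalPow_apply (n : ℕ) (x : MonoidAlgebra ℤ L) :
    evalPow L n x = ∑ a ∈ x.coeff.support, (x.coeff a : L) * a ^ n := by
  simp [evalPow, MonoidAlgebra.lift_apply', Finsupp.sum]

/-- The group of nonzero elements of `L` modulo roots of unity; it is torsion-free. -/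
abbrev UnitsModTorsion (L : Type*) [Field L] : Type _ := Lˣ ⧸ CommGroup.torsion Lˣ

open Classical in
/-- The ring homomorphism `ℤ[(L, ·)] → ℤ[(L, ·)][Lˣ/torsion]` that sends `[a]`, for `a ≠ 0`, to
`[a]` placed in the degree of the class of `a`, and `[0]` to `0`. The coefficient of the image of
`x` at a class is the part of `x` supported on that class. -/
noncomputable def grading (L : Type*) [Field L] :
    MonoidAlgebra ℤ L →+* MonoidAlgebra (MonoidAlgebra ℤ L) (UnitsModTorsion L) :=
  (MonoidAlgebra.lift ℤ _ L
    { toFun := fun a => if h : a = 0 then 0 else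
        MonoidAlgebra.single (QuotientGroup.mk (Units.mk0 a h)) (MonoidAlgebra.single a 1)
      map_one' := by
        rw [dif_neg one_ne_zero, Units.mk0_one, QuotientGroup.mk_one]
        rfl
      map_mul' := fun a b => by
        by_cases ha : a = 0
        · simp [ha]
        by_cases hb : b = 0
        · simp [hb]
        simp [ha, hb, MonoidAlgebra.single_mul_single, Units.mk0_mul] } :
    MonoidAlgebra ℤ L →ₐ[ℤ] MonoidAlgebra (MonoidAlgebra ℤ L) (UnitsModTorsion L)).toRingHom

theorem grading_single_zero (r : ℤ) : grading L (MonoidAlgebra.single 0 r) = 0 := by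
  simp [grading, MonoidAlgebra.lift_apply']

theorem grading_single {a : L} (ha : a ≠ 0) (r : ℤ) :
    grading L (MonoidAlgebra.single a r) =
      MonoidAlgebra.single (QuotientGroup.mk (Units.mk0 a ha)) (MonoidAlgebra.single a r) := by
  simp [grading, MonoidAlgebra.lift_apply, ha, MonoidAlgebra.smul_single]

/-- The support of `x` consists of products of `b` with roots of unity. -/
def IsIsotypic (b : L) (x : MonoidAlgebra ℤ L) : Prop :=
  ∀ a ∈ x.coeff.support, ∃ k : ℕ, 0 < k ∧ a ^ k = b ^ k

theorem isIsotypic_zero (b : L) : IsIsotypic b 0 := by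
  intro a ha
  simp at ha

theorem IsIsotypic.add {b : L} {x y : MonoidAlgebra ℤ L} (hx : IsIsotypic b x)
    (hy : IsIsotypic b y) : IsIsotypic b (x + y) := by
  classical
  intro a ha
  rcases Finset.mem_union.1 (Finsupp.support_add ha) with h | h
  exacts [hx a h, hy a h]

theorem IsIsotypic.mul {b c : L} {x y : MonoidAlgebra ℤ L} (hx : IsIsotypic b x)
    (hy : IsIsotypic c y) : IsIsotypic (b * c) (x * y) := by
  classical
  intro a ha
  obtain ⟨u, hu, v, hv, rfl⟩ := Finset.mem_mul.1 (MonoidAlgebra.support_coeff_mul_subset x y ha)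
  obtain ⟨k, hk, hk'⟩ := hx u hu
  obtain ⟨l, hl, hl'⟩ := hy v hv
  refine ⟨k * l, Nat.mul_pos hk hl, ?_⟩
  rw [mul_pow, mul_pow, pow_mul, hk', ← pow_mul, mul_comm k l, pow_mul v, hl', ← pow_mul]

theorem isIsotypic_coeff_grading (b : Lˣ) (x : MonoidAlgebra ℤ L) :
    IsIsotypic (b : L) ((grading L x).coeff (QuotientGroup.mk b)) := by
  classical
  induction x using MonoidAlgebra.induction_linear with
  | zero => simpa using isIsotypic_zero _
  | add x y hx hy =>
    rw [map_add, MonoidAlgebra.coeff_add, Finsupp.add_apply]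
    exact hx.add hy
  | single a r =>
    by_cases ha : a = 0
    · subst ha
      simpa [grading_single_zero] using isIsotypic_zero _
    rw [grading_single ha, MonoidAlgebra.coeff_single, Finsupp.single_apply]
    split_ifs with h
    · intro c hc
      obtain rfl : c = a := by
        by_contra hne
        simp [Ne.symm hne] at hc
      obtain ⟨k, hk, hk'⟩ := isOfFinOrder_iff_pow_eq_one.1
        ((CommGroup.mem_torsion _).1 (QuotientGroup.eq.1 h))
      refine ⟨k, hk, ?_⟩
      rw [mul_pow, inv_pow, inv_mul_eq_one] at hk'
      simpa using congrArg Units.val hk'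
    · exact isIsotypic_zero _

theorem IsIsotypic.isIntegral_evalPow {b : L} (hb : b ≠ 0) {x : MonoidAlgebra ℤ L}
    (hx : IsIsotypic b x) (n : ℕ) : IsIntegral ℤ (evalPow L n x / b ^ n) := by
  rw [evalPow_apply, Finset.sum_div]
  refine IsIntegral.sum _ fun a ha => ?_
  obtain ⟨k, hk, hk'⟩ := hx a ha
  rw [mul_div_assoc, ← div_pow]
  refine (isIntegral_algebraMap (R := ℤ) (x := x.coeff a)).mul (IsIntegral.pow ?_ n)
  refine IsIntegral.of_pow hk ?_
  rw [div_pow, hk', div_self (pow_ne_zero _ hb)]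
  exact isIntegral_one

/-- The average of the power sums of an element supported on roots of unity, over a full period of
the exponent, is the coefficient at `1`, hence an integer. -/
theorem IsIsotypic.exists_sum_evalPow {x : MonoidAlgebra ℤ L} (hx : IsIsotypic 1 x) (n₀ : ℕ) :
    ∃ N : ℕ, 0 < N ∧ n₀ ≤ N ∧ ∃ m : ℤ, ∑ n ∈ Finset.range N, evalPow L (n + 1) x = N * m := by
  classical
  choose! k hk hk' using hx
  have hP : 0 < ∏ a ∈ x.coeff.support, k a := Finset.prod_pos hk
  refine ⟨(n₀ + 1) * ∏ a ∈ x.coeff.support, k a, Nat.mul_pos n₀.succ_pos hP, ?_, x.coeff 1, ?_⟩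
  · exact n₀.le_succ.trans (Nat.le_mul_of_pos_right _ hP)
  set N := (n₀ + 1) * ∏ a ∈ x.coeff.support, k a with hN
  have hsum : ∀ a ∈ x.coeff.support,
      ∑ n ∈ Finset.range N, a ^ (n + 1) = if a = 1 then (N : L) else 0 := by
    intro a ha
    split_ifs with h
    · simp [h]
    have haN : a ^ N = 1 := by
      obtain ⟨c, hc⟩ := (Finset.dvd_prod_of_mem k ha).trans (Dvd.intro_left (n₀ + 1) hN.symm)
      rw [hc, pow_mul, hk' a ha, one_pow, one_pow]
    have hgeom := mul_geom_sum a N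
    rw [haN, sub_self] at hgeom
    have h0 := (mul_eq_zero.1 hgeom).resolve_left (sub_ne_zero.2 h)
    simp_rw [pow_succ, ← Finset.sum_mul, h0, zero_mul]
  simp_rw [evalPow_apply]
  rw [Finset.sum_comm]
  simp_rw [← Finset.mul_sum]
  rw [Finset.sum_congr rfl fun a ha => by rw [hsum a ha]]
  simp only [mul_ite, mul_zero]
  rw [Finset.sum_ite_eq']
  split_ifs with h
  · ring
  · simp [Finsupp.notMem_support_iff.1 h]

/-- For `n > 0` the `n`-th power sum only sees the nonzero elements of `L`, so it is the sum of
the power sums of the parts of `x` supported on the classes modulo roots of unity. -/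
theorem evalPow_eq_sum_grading {n : ℕ} (hn : 0 < n) (x : MonoidAlgebra ℤ L) :
    evalPow L n x = (MonoidAlgebra.mapRingHom (UnitsModTorsion L) (evalPow L n)
      (grading L x)).coeff.sum fun _ c => c := by
  induction x using MonoidAlgebra.induction_linear with
  | zero => simp
  | add x y hx hy =>
    rw [map_add, map_add, map_add, MonoidAlgebra.coeff_add,
      Finsupp.sum_add_index' (fun _ => rfl) (fun _ _ _ => rfl), hx, hy]
  | single a r =>
    by_cases ha : a = 0
    · subst ha
      simp [grading_single_zero, evalPow_single, hn.ne']
    · rw [grading_single ha, MonoidAlgebra.mapRingHom_single, MonoidAlgebra.coeff_single,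
        Finsupp.sum_single_index rfl]

/-- A unit of `ℤ[(L, ·)]` is, apart from a multiple of `[0]`, supported on a single class of `Lˣ`
modulo roots of unity. This is recorded through power sums: for some `b`, all `n`-th power sums
with `n > 0` of the unit and its inverse are those of elements supported on the classes of `b` and
`b⁻¹`. -/
theorem exists_isIsotypic_of_mul_eq_one [CharZero L] {U V : MonoidAlgebra ℤ L} (h : U * V = 1) :
    ∃ (b : Lˣ) (U' V' : MonoidAlgebra ℤ L), IsIsotypic (b : L) U' ∧
      IsIsotypic ((b⁻¹ : Lˣ) : L) V' ∧
      ∀ n : ℕ, 0 < n → evalPow L n U = evalPow L n U' ∧ evalPow L n V = evalPow L n V' := by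
  classical
  have : TwoUniqueProds (UnitsModTorsion L) := CommGroup.twoUniqueProds_of_isMulTorsionFree _
  have hΦ (n : ℕ) := MonoidAlgebra.exists_eq_single_of_mul_eq_one
    (show MonoidAlgebra.mapRingHom (UnitsModTorsion L) (evalPow L n) (grading L U) *
      MonoidAlgebra.mapRingHom (UnitsModTorsion L) (evalPow L n) (grading L V) = 1 by
        rw [← map_mul, ← map_mul, h, map_one, map_one])
  choose f c d hcd hU hV using hΦ
  obtain ⟨b, hb⟩ := QuotientGroup.mk_surjective (f 1)
  have hb' : QuotientGroup.mk b⁻¹ = (f 1)⁻¹ := by rw [QuotientGroup.mk_inv, hb]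
  have hUb := isIsotypic_coeff_grading b U
  have hVb := isIsotypic_coeff_grading b⁻¹ V
  have hcU (n : ℕ) (g) : evalPow L n ((grading L U).coeff g) = if f n = g then c n else 0 := by
    rw [← MonoidAlgebra.coeff_mapRingHom, hU, MonoidAlgebra.coeff_single, Finsupp.single_apply]
  have hcV (n : ℕ) (g) :
      evalPow L n ((grading L V).coeff g) = if (f n)⁻¹ = g then d n else 0 := by
    rw [← MonoidAlgebra.coeff_mapRingHom, hV, MonoidAlgebra.coeff_single, Finsupp.single_apply]
  -- The product of the parts of `U` and `V` at `f 1` and its inverse has `n`-th power sum `1` or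
  -- `0` according to whether `f n = f 1`; as the averages are integers, they are all `1`.
  have hf : ∀ n₀ : ℕ, f (n₀ + 1) = f 1 := by
    intro n₀
    have hE := hUb.mul hVb
    rw [← Units.val_mul, mul_inv_cancel, Units.val_one] at hE
    obtain ⟨N, hN0, hN, m, hm⟩ := hE.exists_sum_evalPow (n₀ + 1)
    have hterm (n : ℕ) : evalPow L n ((grading L U).coeff (QuotientGroup.mk b) *
        (grading L V).coeff (QuotientGroup.mk b⁻¹)) = if f n = f 1 then 1 else 0 := by
      rw [map_mul, hcU, hcV, hb', hb]
      by_cases hn : f n = f 1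
      · simp [hn, hcd]
      · simp [hn]
    simp_rw [hterm] at hm
    rw [Finset.sum_boole] at hm
    set S := (Finset.range N).filter fun n => f (n + 1) = f 1 with hS
    have hm' : (S.card : ℤ) = N * m := by exact_mod_cast hm
    have hpos : 0 < S.card := Finset.card_pos.2 ⟨0, by simp [hS, hN0]⟩
    have hdvd : N ∣ S.card := by
      rw [← Int.natCast_dvd_natCast]
      exact ⟨m, hm'⟩
    have hle := Nat.le_of_dvd hpos hdvd
    have hSN : S = Finset.range N :=
      Finset.eq_of_subset_of_card_le (Finset.filter_subset _ _) (by simpa using hle)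
    have hmem : n₀ ∈ S := by
      rw [hSN, Finset.mem_range]
      exact hN
    exact (Finset.mem_filter.1 hmem).2
  refine ⟨b, _, _, hUb, hVb, fun n hn => ?_⟩
  obtain ⟨n, rfl⟩ := Nat.exists_eq_add_of_lt hn
  rw [zero_add]
  rw [evalPow_eq_sum_grading n.succ_pos U, evalPow_eq_sum_grading n.succ_pos V, hcU, hcV, hU, hV, hb,
    hb', MonoidAlgebra.coeff_single, MonoidAlgebra.coeff_single, Finsupp.sum_single_index rfl,
    Finsupp.sum_single_index rfl, hf n, if_pos rfl, if_pos rfl]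
  exact ⟨rfl, rfl⟩

/-- The `n`-th power sum of a unit agrees with the `n`-th power of its first power sum up to a unit
of the ring of algebraic integers. -/
theorem isIntegral_evalPow_mul_of_mul_eq_one [CharZero L] {U V : MonoidAlgebra ℤ L}
    (h : U * V = 1) {n : ℕ} (hn : 0 < n) :
    IsIntegral ℤ (evalPow L n U * evalPow L 1 V ^ n) := by
  obtain ⟨b, U', V', hU', hV', hpow⟩ := exists_isIsotypic_of_mul_eq_one h
  have h1 := hU'.isIntegral_evalPow b.ne_zero n
  have h2 := (hV'.isIntegral_evalPow b⁻¹.ne_zero 1).pow n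
  have h3 := h1.mul h2
  rw [(hpow n hn).1, (hpow 1 one_pos).2]
  have hb := b.ne_zero
  have heq : evalPow L n U' / (b : L) ^ n * (evalPow L 1 V' / ((b⁻¹ : Lˣ) : L) ^ 1) ^ n =
      evalPow L n U' * evalPow L 1 V' ^ n := by
    rw [Units.val_inv_eq_inv_val, pow_one, div_pow, inv_pow]
    field_simp
  rwa [heq] at h3

/-- An element of `ℤ[(L, ·)]` is determined by its power sums, by linear independence of the
characters `n ↦ a ^ n`. -/
theorem eq_of_evalPow_eq [CharZero L] {x y : MonoidAlgebra ℤ L}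
    (h : ∀ n, evalPow L n x = evalPow L n y) : x = y := by
  rw [← sub_eq_zero]
  set z := x - y with hz
  have hz0 : ∀ n, evalPow L n z = 0 := fun n => by rw [hz, map_sub, h n, sub_self]
  have hli := (linearIndependent_monoidHom (Multiplicative ℕ) L).comp (powersHom L)
    (powersHom L).injective
  rw [linearIndependent_iff'] at hli
  have key := hli z.coeff.support (fun a => (z.coeff a : L)) (by
    funext n
    have := hz0 n.toAdd
    rw [evalPow_apply] at this
    simpa [Finset.sum_apply] using this)
  rw [← MonoidAlgebra.coeff_eq_zero, ← Finsupp.support_eq_empty]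
  refine Finset.eq_empty_of_forall_notMem fun a ha => ?_
  exact (Finsupp.mem_support_iff.1 ha) (by exact_mod_cast key a ha)

end PowerSums

end MonicRatio

/-! ### Integrality and field embeddings -/

/-- If `2 ^ p / 2 ^ q` is an algebraic integer, then `q ≤ p`. -/
theorem le_of_isIntegral_two_pow_mul {K : Type*} [Field K] [CharZero K] {p q : ℕ}
    (h : IsIntegral ℤ ((2 : K) ^ p * (2⁻¹ : K) ^ q)) : q ≤ p := by
  by_contra! hlt
  have h1 : ((2 : K) ^ p * (2⁻¹ : K) ^ q) = (2⁻¹ : K) ^ (q - p) := by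
    obtain ⟨r, rfl⟩ := Nat.exists_eq_add_of_lt hlt
    rw [add_assoc, pow_add, ← mul_assoc, ← mul_pow, mul_inv_cancel₀ two_ne_zero, one_pow, one_mul,
      Nat.add_sub_cancel_left]
  rw [h1] at h
  have h2 : IsIntegral ℤ (algebraMap ℚ K (2⁻¹ : ℚ)) := by
    simpa using h.of_pow (Nat.sub_pos_of_lt hlt)
  rw [isIntegral_algebraMap_iff (algebraMap ℚ K).injective, IsIntegrallyClosed.isIntegral_iff] at h2
  obtain ⟨y, hy⟩ := h2
  have h3 : ((2 * y : ℤ) : ℚ) = 1 := by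
    rw [Int.cast_mul, Int.cast_ofNat, show (y : ℚ) = 2⁻¹ from hy]
    norm_num
  have h4 : 2 * y = 1 := by exact_mod_cast h3
  omega

/-- An algebraic number `d` such that `d / (y + m)` is an algebraic integer for all large natural
numbers `m` vanishes: for `m` large, all conjugates of `d / (y + m)` have absolute value less
than `1`. -/
theorem eq_zero_of_forall_isIntegral_div {K : Type*} [Field K] [CharZero K]
    [Algebra.IsAlgebraic ℚ K] {d y : K}
    (h : ∀ m : ℕ, y + m ≠ 0 → IsIntegral ℤ (d / (y + m))) : d = 0 := by
  by_contra hd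
  let F := IntermediateField.adjoin ℚ ({d, y} : Set K)
  have : FiniteDimensional ℚ F :=
    IntermediateField.finiteDimensional_adjoin fun x _ => Algebra.IsIntegral.isIntegral x
  have : NumberField F := ⟨⟩
  let d' : F := ⟨d, IntermediateField.subset_adjoin ℚ _ (by simp)⟩
  let y' : F := ⟨y, IntermediateField.subset_adjoin ℚ _ (by simp)⟩
  obtain ⟨m, hm⟩ := exists_nat_gt (∑ ψ : F →+* ℂ, (‖ψ d'‖ + ‖ψ y'‖))
  have hlt (ψ : F →+* ℂ) : ‖ψ d'‖ < ‖ψ (y' + m)‖ := by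
    have h1 : ‖ψ d'‖ + ‖ψ y'‖ ≤ ∑ ψ : F →+* ℂ, (‖ψ d'‖ + ‖ψ y'‖) :=
      Finset.single_le_sum (f := fun ψ : F →+* ℂ => ‖ψ d'‖ + ‖ψ y'‖)
        (fun _ _ => by positivity) (Finset.mem_univ ψ)
    have h2 : (m : ℝ) - ‖ψ y'‖ ≤ ‖ψ (y' + m)‖ := by
      have := norm_sub_norm_le (m : ℂ) (-ψ y')
      rw [norm_neg, sub_neg_eq_add, Complex.norm_natCast] at this
      rwa [map_add, map_natCast, add_comm (ψ y')]
    linarith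
  obtain ⟨ψ₀⟩ : Nonempty (F →+* ℂ) := inferInstance
  have hne : y' + m ≠ 0 := fun h0 => by
    have := hlt ψ₀
    rw [h0, map_zero, norm_zero] at this
    exact this.not_ge (norm_nonneg _)
  have hd' : d' ≠ 0 := fun h0 => hd (congrArg Subtype.val h0)
  have hint : IsIntegral ℤ (d' / (y' + m)) := by
    rw [← isIntegral_algebraMap_iff (algebraMap F K).injective]
    have := h m fun h0 => hne (Subtype.ext (by simpa [y'] using h0))
    simpa [d', y'] using this
  have hnorm (ψ : F →+* ℂ) : ‖ψ (d' / (y' + m))‖ < 1 := by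
    rw [map_div₀, norm_div]
    exact (div_lt_one ((norm_nonneg _).trans_lt (hlt ψ))).2 (hlt ψ)
  obtain ⟨n, hn, hn'⟩ := NumberField.Embeddings.pow_eq_one_of_norm_le_one F ℂ
    (div_ne_zero hd' hne) hint fun ψ => (hnorm ψ).le
  have h1 := pow_lt_one₀ (norm_nonneg _) (hnorm ψ₀) hn.ne'
  rw [← norm_pow, ← map_pow, hn', map_one, norm_one] at h1
  exact lt_irrefl _ h1

/-- Two embeddings of an algebraic field whose quotient takes integral values coincide. -/
theorem ringHom_eq_of_isIntegral_div {K : Type*} [Field K] [CharZero K]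
    [Algebra.IsAlgebraic ℚ K] {σ σ' : K →+* K}
    (h : ∀ a : K, a ≠ 0 → IsIntegral ℤ (σ a / σ' a)) : σ = σ' := by
  ext x
  rw [← sub_eq_zero]
  refine eq_zero_of_forall_isIntegral_div (y := σ' x) fun m hm => ?_
  have hxm : x + m ≠ 0 := fun h0 => hm (by rw [← map_natCast σ' m, ← map_add, h0, map_zero])
  have h1 := (h _ hxm).sub isIntegral_one
  rw [map_add, map_add, map_natCast, map_natCast, div_sub_one hm] at h1
  rwa [show σ x - σ' x = σ x + m - (σ' x + m) by ring]

namespace MonicRatio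

/-! ### Galois descent -/

section Descent

variable {K : Type*} [Field K]

theorem aroots_map_algEquiv (f : K[X]) (g : AlgebraicClosure K ≃ₐ[K] AlgebraicClosure K) :
    (f.aroots (AlgebraicClosure K)).map g = f.aroots (AlgebraicClosure K) := by
  have h := ((IsAlgClosed.splits (f.map (algebraMap K (AlgebraicClosure K)))).roots_map
    (g : AlgebraicClosure K →+* AlgebraicClosure K)).symm
  rw [Polynomial.map_map, show (g : AlgebraicClosure K →+* AlgebraicClosure K).comp
    (algebraMap K (AlgebraicClosure K)) = algebraMap K (AlgebraicClosure K) by ext a; simp] at h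
  exact h

/-- A multiset of elements of the algebraic closure that is stable under the absolute Galois group
is the multiset of roots of a monic polynomial over the base field. -/
theorem exists_map_eq_prod_of_map_eq [CharZero K] (s : Multiset (AlgebraicClosure K))
    (hs : ∀ g : AlgebraicClosure K ≃ₐ[K] AlgebraicClosure K, s.map g = s) :
    ∃ h : K[X], h.Monic ∧
      h.map (algebraMap K (AlgebraicClosure K)) = (s.map fun α => X - C α).prod := by
  set H := (s.map fun α => X - C α).prod with hH
  have hmonic : H.Monic := monic_multiset_prod_of_monic _ _ fun a _ => monic_X_sub_C a
  have hfix (g : AlgebraicClosure K ≃ₐ[K] AlgebraicClosure K) :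
      H.map (g : AlgebraicClosure K →+* AlgebraicClosure K) = H := by
    rw [hH, Polynomial.map_multiset_prod, Multiset.map_map]
    conv_rhs => rw [← hs g, Multiset.map_map]
    simp
  have hlift : H ∈ Polynomial.lifts (algebraMap K (AlgebraicClosure K)) := by
    rw [Polynomial.lifts_iff_coeff_lifts]
    intro n
    refine (InfiniteGalois.mem_range_algebraMap_iff_fixed _).2 fun g => ?_
    conv_rhs => rw [← hfix g]
    rw [coeff_map]
    rfl
  obtain ⟨h, hh, -, hm⟩ := lifts_and_natDegree_eq_and_monic hlift hmonic
  exact ⟨h, hm, hh⟩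

end Descent

/-! ### The power sums as ring homomorphisms to `K` -/

section Ring

variable {K : Type*} [Field K]

theorem evalPow_rootSum (n : ℕ) (f : K[X]) : evalPow (AlgebraicClosure K) n (rootSum f) =
    ((f.aroots (AlgebraicClosure K)).map fun α => α ^ n).sum := by
  rw [rootSum, map_multiset_sum, Multiset.map_map]
  simp [evalPow_single]

theorem powerSum_eq_evalPow (n : ℕ) (r : MonicRatio K) :
    powerSum n r = evalPow (AlgebraicClosure K) n (divisor r) := by
  rw [divisor, map_sub, evalPow_rootSum, evalPow_rootSum, powerSum]

/-- The class `[x - a]`. -/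
noncomputable def linear (a : K) : MonicRatio K := ofPoly (X - C a) (monic_X_sub_C a)

theorem divisor_linear (a : K) : divisor (linear a) =
    MonoidAlgebra.single (algebraMap K (AlgebraicClosure K) a) 1 := by
  rw [linear, divisor_ofPoly, rootSum, aroots_X_sub_C, Multiset.map_singleton,
    Multiset.sum_singleton]

variable [CharZero K]

/-- The divisor as a ring homomorphism. -/
noncomputable def divisorHom (K : Type*) [Field K] [CharZero K] :
    MonicRatio K →+* MonoidAlgebra ℤ (AlgebraicClosure K) where
  toFun := divisor
  map_one' := divisor_one
  map_mul' := divisor_mul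
  map_zero' := (divisor_ofPoly 1 monic_one).trans rootSum_one
  map_add' := divisor_add

theorem powerSum_mem_range (n : ℕ) (r : MonicRatio K) :
    powerSum n r ∈ Set.range (algebraMap K (AlgebraicClosure K)) := by
  refine (InfiniteGalois.mem_range_algebraMap_iff_fixed _).2 fun g => ?_
  have key (f : K[X]) : g ((f.aroots (AlgebraicClosure K)).map fun α => α ^ n).sum =
      ((f.aroots (AlgebraicClosure K)).map fun α => α ^ n).sum := by
    conv_rhs => rw [← aroots_map_algEquiv f g]
    rw [map_multiset_sum, Multiset.map_map, Multiset.map_map]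
    simp
  rw [powerSum, map_sub, key, key]

/-- The isomorphism of `K` with its image in the algebraic closure. -/
noncomputable def equivRange (K : Type*) [Field K] :
    K ≃+* (algebraMap K (AlgebraicClosure K)).range :=
  RingEquiv.ofBijective (algebraMap K (AlgebraicClosure K)).rangeRestrict
    ⟨fun _ _ h => (algebraMap K (AlgebraicClosure K)).injective (congrArg Subtype.val h),
      (algebraMap K (AlgebraicClosure K)).rangeRestrict_surjective⟩

/-- The map `t_n` as a ring homomorphism to `K`. -/
noncomputable def powerSumHom (K : Type*) [Field K] [CharZero K] (n : ℕ) : MonicRatio K →+* K :=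
  ((equivRange K).symm : (algebraMap K (AlgebraicClosure K)).range →+* K).comp
    (((evalPow (AlgebraicClosure K) n).comp (divisorHom K)).codRestrict
      (algebraMap K (AlgebraicClosure K)).range fun r => by
        have := powerSum_mem_range n r
        rwa [powerSum_eq_evalPow] at this)

theorem algebraMap_powerSumHom (n : ℕ) (r : MonicRatio K) :
    algebraMap K (AlgebraicClosure K) (powerSumHom K n r) =
      evalPow (AlgebraicClosure K) n (divisorHom K r) :=
  congrArg Subtype.val ((equivRange K).apply_symm_apply _)

theorem powerSum_eq_algebraMap (n : ℕ) (r : MonicRatio K) :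
    powerSum n r = algebraMap K (AlgebraicClosure K) (powerSumHom K n r) := by
  rw [algebraMap_powerSumHom, powerSum_eq_evalPow]
  rfl

theorem exists_powerSumHom_zero_eq_intCast (r : MonicRatio K) :
    ∃ z : ℤ, powerSumHom K 0 r = z := by
  refine ⟨Multiset.card (r.val.num.aroots (AlgebraicClosure K)) -
    Multiset.card (r.val.denom.aroots (AlgebraicClosure K)), ?_⟩
  apply (algebraMap K (AlgebraicClosure K)).injective
  rw [← powerSum_eq_algebraMap, powerSum]
  simp

/-- For `i > 0` the map `t_i` is onto `K`: it takes the value `c` at `[x ^ i - c / i]`. -/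
theorem powerSumHom_surjective {i : ℕ} (hi : 0 < i) : Function.Surjective (powerSumHom K i) := by
  intro c
  set f : K[X] := X ^ i - C (c / i) with hf
  have hm : f.Monic := monic_X_pow_sub_C _ hi.ne'
  refine ⟨ofPoly f hm, (algebraMap K (AlgebraicClosure K)).injective ?_⟩
  rw [algebraMap_powerSumHom]
  change evalPow _ i (divisor (ofPoly f hm)) = _
  rw [divisor_ofPoly, evalPow_rootSum]
  have hroot : ∀ α ∈ f.aroots (AlgebraicClosure K),
      α ^ i = algebraMap K (AlgebraicClosure K) (c / i) := by
    intro α hα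
    have h0 := (mem_aroots.1 hα).2
    rwa [hf, map_sub, map_pow, aeval_X, aeval_C, sub_eq_zero] at h0
  rw [Multiset.map_congr rfl hroot, Multiset.map_const', Multiset.sum_replicate,
    IsAlgClosed.card_aroots_eq_natDegree, hf, natDegree_X_pow_sub_C, nsmul_eq_mul,
    ← map_natCast (algebraMap K (AlgebraicClosure K)), ← map_mul,
    mul_div_cancel₀ _ (Nat.cast_ne_zero.2 hi.ne')]

theorem linear_mul_linear_inv {a : K} (ha : a ≠ 0) : linear a * linear a⁻¹ = 1 :=
  divisor_injective (by
    rw [divisor_mul, divisor_linear, divisor_linear, MonoidAlgebra.single_mul_single, ← map_mul,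
      mul_inv_cancel₀ ha, map_one, mul_one, divisor_one, MonoidAlgebra.one_def])

theorem powerSumHom_linear (n : ℕ) (a : K) : powerSumHom K n (linear a) = a ^ n := by
  apply (algebraMap K (AlgebraicClosure K)).injective
  rw [algebraMap_powerSumHom]
  change evalPow _ n (divisor (linear a)) = _
  rw [divisor_linear, evalPow_single, Int.cast_one, one_mul, map_pow]

/-! ### Continuous endomorphisms on power sums -/

/-- By continuity `t_n ∘ φ` kills the intersection of finitely many of the kernels of the `t_i`;
its kernel being prime, it contains one of them. -/
theorem exists_ker_powerSumHom_le {φ : MonicRatio K →+* MonicRatio K} (hφ : Continuous φ)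
    (n : ℕ) : ∃ i, RingHom.ker (powerSumHom K i) ≤ RingHom.ker ((powerSumHom K n).comp φ) := by
  let _ : TopologicalSpace (AlgebraicClosure K) := ⊥
  have : DiscreteTopology (AlgebraicClosure K) := ⟨rfl⟩
  have hcont : Continuous fun r : MonicRatio K => powerSum n (φ r) :=
    ((continuous_apply n).comp continuous_induced_dom).comp hφ
  obtain ⟨O, hO, hO'⟩ := isOpen_induced_iff.1
    ((isOpen_discrete ({0} : Set (AlgebraicClosure K))).preimage hcont)
  have hzero (i : ℕ) : powerSum i (0 : MonicRatio K) = 0 := by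
    rw [powerSum_eq_algebraMap, map_zero, map_zero]
  have h0 : (fun i => powerSum i (0 : MonicRatio K)) ∈ O := by
    change (0 : MonicRatio K) ∈ (fun r i => powerSum i r) ⁻¹' O
    rw [hO']
    simp [hzero]
  obtain ⟨I, u, hu, hI⟩ := isOpen_pi_iff.1 hO _ h0
  have hle : I.inf (fun i => RingHom.ker (powerSumHom K i)) ≤
      RingHom.ker ((powerSumHom K n).comp φ) := by
    intro r hr
    rw [Submodule.mem_finsetInf] at hr
    have hrO : r ∈ (fun (r : MonicRatio K) i => powerSum i r) ⁻¹' O := by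
      refine hI fun i hi => ?_
      have h1 : powerSum i r = 0 := by
        rw [powerSum_eq_algebraMap, (RingHom.mem_ker).1 (hr i hi), map_zero]
      have h2 := (hu i hi).2
      rw [hzero] at h2
      change powerSum i r ∈ u i
      rwa [h1]
    rw [hO'] at hrO
    have h3 : powerSum n (φ r) = 0 := hrO
    rw [powerSum_eq_algebraMap, map_eq_zero] at h3
    exact h3
  obtain ⟨i, -, hi⟩ := (RingHom.ker_isPrime _).inf_le'.1 hle
  exact ⟨i, hi⟩

/-- Each `t_n ∘ φ` is some `t_i` followed by a field embedding. -/
theorem exists_powerSumHom_comp_eq {φ : MonicRatio K →+* MonicRatio K} (hφ : Continuous φ)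
    (n : ℕ) : ∃ (i : ℕ) (σ : K →+* K), ∀ r, powerSumHom K n (φ r) = σ (powerSumHom K i r) := by
  obtain ⟨i, hi⟩ := exists_ker_powerSumHom_le hφ n
  rcases Nat.eq_zero_or_pos i with rfl | hpos
  · refine ⟨0, RingHom.id K, fun r => ?_⟩
    obtain ⟨z, hz⟩ := exists_powerSumHom_zero_eq_intCast r
    have hmem : r - (z : MonicRatio K) ∈ RingHom.ker (powerSumHom K 0) := by
      rw [RingHom.mem_ker, map_sub, map_intCast, hz, sub_self]
    have h := RingHom.mem_ker.1 (hi hmem)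
    rw [map_sub, map_intCast, sub_eq_zero] at h
    rw [RingHom.id_apply, hz]
    exact h
  · exact ⟨i, (powerSumHom K i).liftOfSurjective (powerSumHom_surjective hpos) ⟨_, hi⟩, fun r =>
      ((powerSumHom K i).liftOfSurjective_comp_apply _ ⟨_, hi⟩ r).symm⟩

/-- Since `t_0` takes integral values, `t_0 ∘ φ` can only be `t_0`. -/
theorem powerSumHom_zero_comp {φ : MonicRatio K →+* MonicRatio K} (hφ : Continuous φ)
    (r : MonicRatio K) : powerSumHom K 0 (φ r) = powerSumHom K 0 r := by
  obtain ⟨i, σ, h⟩ := exists_powerSumHom_comp_eq hφ 0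
  rcases Nat.eq_zero_or_pos i with rfl | hpos
  · obtain ⟨z, hz⟩ := exists_powerSumHom_zero_eq_intCast r
    rw [h, hz, map_intCast]
  · obtain ⟨s, hs⟩ := powerSumHom_surjective hpos (2⁻¹ : K)
    obtain ⟨z, hz⟩ := exists_powerSumHom_zero_eq_intCast (φ s)
    have h1 := h s
    rw [hz, hs, map_inv₀, map_ofNat, ← one_div, eq_div_iff two_ne_zero] at h1
    have h2 : z * 2 = 1 := by exact_mod_cast h1
    omega

theorem isIntegral_powerSumHom_linear (φ : MonicRatio K →+* MonicRatio K) {a : K} (ha : a ≠ 0)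
    {n : ℕ} (hn : 0 < n) : IsIntegral ℤ
      (powerSumHom K n (φ (linear a)) * powerSumHom K 1 (φ (linear a⁻¹)) ^ n) := by
  have h := isIntegral_evalPow_mul_of_mul_eq_one
    (show divisorHom K (φ (linear a)) * divisorHom K (φ (linear a⁻¹)) = 1 by
      rw [← map_mul, ← map_mul, linear_mul_linear_inv ha, map_one, map_one]) hn
  rw [← algebraMap_powerSumHom, ← algebraMap_powerSumHom, ← map_pow, ← map_mul] at h
  exact (isIntegral_algebraMap_iff (algebraMap K (AlgebraicClosure K)).injective).1 h

/-- A continuous endomorphism satisfies `t_n ∘ φ = σ ∘ t_{k n}` for some `k` and `σ` that do not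
depend on `n`. -/
theorem exists_powerSumHom_comp_eq_mul [Algebra.IsAlgebraic ℚ K]
    {φ : MonicRatio K →+* MonicRatio K} (hφ : Continuous φ) :
    ∃ (k : ℕ) (σ : K →+* K), ∀ n r, powerSumHom K n (φ r) = σ (powerSumHom K (k * n) r) := by
  choose k σ h using exists_powerSumHom_comp_eq hφ
  have hlin (n : ℕ) (a : K) : powerSumHom K n (φ (linear a)) = σ n a ^ k n := by
    rw [h, powerSumHom_linear, map_pow]
  have hint {n : ℕ} (hn : 0 < n) {a : K} (ha : a ≠ 0) :
      IsIntegral ℤ (σ n a ^ k n * (σ 1 a)⁻¹ ^ (k 1 * n)) := by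
    have := isIntegral_powerSumHom_linear φ ha hn
    rwa [hlin, hlin, ← pow_mul, map_inv₀] at this
  -- At `a = 2` and `a = 1 / 2` integrality compares the exponents in both directions.
  have hk {n : ℕ} (hn : 0 < n) : k n = k 1 * n := by
    refine le_antisymm ?_ ?_
    · refine le_of_isIntegral_two_pow_mul (K := K) ?_
      simpa [mul_comm, map_ofNat] using hint hn (a := 2⁻¹) (inv_ne_zero two_ne_zero)
    · refine le_of_isIntegral_two_pow_mul (K := K) ?_
      simpa [map_ofNat] using hint hn (a := 2) two_ne_zero
  have hcast (τ : K →+* K) (r : MonicRatio K) :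
      τ (powerSumHom K 0 r) = powerSumHom K 0 r := by
    obtain ⟨z, hz⟩ := exists_powerSumHom_zero_eq_intCast r
    rw [hz, map_intCast]
  refine ⟨k 1, σ 1, fun n r => ?_⟩
  rcases Nat.eq_zero_or_pos n with rfl | hn
  · rw [mul_zero, hcast, powerSumHom_zero_comp hφ]
  rw [h, hk hn]
  rcases Nat.eq_zero_or_pos (k 1) with h1 | h1
  · rw [h1, zero_mul, hcast, hcast]
  · congr 1
    refine ringHom_eq_of_isIntegral_div fun a ha => ?_
    have := hint hn ha
    rw [hk hn, ← mul_pow] at this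
    rw [div_eq_mul_inv]
    exact this.of_pow (Nat.mul_pos h1 hn)

/-! ### Recovering the endomorphism -/

/-- For a field automorphism `τ` of the algebraic closure preserving `K`, the polynomial whose
roots are the `k`-th powers of the images under `τ` of the roots of `f` has coefficients
in `K`. -/
theorem exists_map_eq_prod_pow (σ : K ≃+* K) (τ : AlgebraicClosure K ≃+* AlgebraicClosure K)
    (hτ : ∀ a : K, τ (algebraMap K (AlgebraicClosure K) a) =
      algebraMap K (AlgebraicClosure K) (σ a)) (k : ℕ) (f : K[X]) :
    ∃ h : K[X], h.Monic ∧ h.map (algebraMap K (AlgebraicClosure K)) =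
      ((f.aroots (AlgebraicClosure K)).map fun α => X - C (τ α ^ k)).prod := by
  obtain ⟨h, hm, hh⟩ := exists_map_eq_prod_of_map_eq
    ((f.aroots (AlgebraicClosure K)).map fun α => τ α ^ k) fun g => by
      -- `τ⁻¹ g τ` fixes `K`, so it permutes the roots of `f`.
      let g' : AlgebraicClosure K ≃ₐ[K] AlgebraicClosure K :=
        AlgEquiv.ofRingEquiv (f := (τ.trans g.toRingEquiv).trans τ.symm) fun a => by
          change τ.symm (g (τ _)) = _
          rw [hτ, g.commutes, ← hτ, RingEquiv.symm_apply_apply]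
      have hg' (α : AlgebraicClosure K) : τ (g' α) = g (τ α) := τ.apply_symm_apply _
      conv_rhs => rw [← aroots_map_algEquiv f g']
      simp [Multiset.map_map, hg']
  exact ⟨h, hm, by rw [hh, Multiset.map_map]; rfl⟩

theorem eq_ofPoly_of_forall_powerSumHom (σ : K ≃+* K)
    (τ : AlgebraicClosure K ≃+* AlgebraicClosure K)
    (hτ : ∀ a : K, τ (algebraMap K (AlgebraicClosure K) a) =
      algebraMap K (AlgebraicClosure K) (σ a)) {k : ℕ} {f h : K[X]} (hf : f.Monic) (hm : h.Monic)
    (hh : h.map (algebraMap K (AlgebraicClosure K)) =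
      ((f.aroots (AlgebraicClosure K)).map fun α => X - C (τ α ^ k)).prod) {r : MonicRatio K}
    (hr : ∀ n, powerSumHom K n r = σ (powerSumHom K (k * n) (ofPoly f hf))) :
    r = ofPoly h hm := by
  refine divisor_injective (eq_of_evalPow_eq fun n => ?_)
  have hroots : h.aroots (AlgebraicClosure K) =
      (f.aroots (AlgebraicClosure K)).map fun α => τ α ^ k := by
    have h1 := Polynomial.roots_multiset_prod_X_sub_C
      ((f.aroots (AlgebraicClosure K)).map fun α => τ α ^ k)
    rw [Multiset.map_map] at h1
    rw [aroots_def, hh]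
    exact h1
  have h1 : evalPow (AlgebraicClosure K) n (divisor r) =
      τ (evalPow (AlgebraicClosure K) (k * n) (divisor (ofPoly f hf))) := by
    have h2 := algebraMap_powerSumHom n r
    rw [hr, ← hτ, algebraMap_powerSumHom] at h2
    exact h2.symm
  rw [h1, divisor_ofPoly, divisor_ofPoly, evalPow_rootSum, evalPow_rootSum, hroots,
    map_multiset_sum, Multiset.map_map, Multiset.map_map]
  simp [pow_mul]

end Ring

end MonicRatio

theorem theorem1 {K : Type*} [Field K] [CharZero K] [Algebra.IsAlgebraic ℚ K]
    (φ : MonicRatio K →+* MonicRatio K) (hφ : Continuous φ) :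
    (∃ (k s : ℕ) (σ : K ≃ₐ[ℚ] K) (τ : AlgebraicClosure K ≃+* AlgebraicClosure K),
      (∀ a : K, τ (algebraMap K (AlgebraicClosure K) a) =
        algebraMap K (AlgebraicClosure K) (σ a)) ∧
      ∀ (f : K[X]) (hf : f.Monic), ∃ (e : ℤ) (h : K[X]),
        (e : AlgebraicClosure K) =
          ((f.aroots (AlgebraicClosure K)).map fun α => α ^ s - 1).sum ∧
        h.map (algebraMap K (AlgebraicClosure K)) =
          ((f.aroots (AlgebraicClosure K)).map fun α => X - C (τ α ^ k)).prod ∧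
        (φ (MonicRatio.ofPoly f hf)).val = RatFunc.X ^ e * algebraMap K[X] (RatFunc K) h) ∨
    ((∀ (r : MonicRatio K) (α : AlgebraicClosure K), (φ r).IsRootOf α →
        ∃ n : ℕ, 0 < n ∧ α ^ n = 1) ∧
      (FiniteDimensional ℚ K → ∃ N : ℕ, 0 < N ∧
        ∀ (r : MonicRatio K) (α : AlgebraicClosure K), (φ r).IsRootOf α → α ^ N = 1)) := by
  obtain ⟨k, σ₀, h₀⟩ := MonicRatio.exists_powerSumHom_comp_eq_mul hφ
  let σ : K ≃ₐ[ℚ] K :=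
    AlgEquiv.ofBijective σ₀.toRatAlgHom (Algebra.IsAlgebraic.algHom_bijective σ₀.toRatAlgHom)
  let τ : AlgebraicClosure K ≃+* AlgebraicClosure K :=
    IsAlgClosure.equivOfEquiv (AlgebraicClosure K) (AlgebraicClosure K) σ.toRingEquiv
  have hτ (a : K) : τ (algebraMap K (AlgebraicClosure K) a) =
      algebraMap K (AlgebraicClosure K) (σ.toRingEquiv a) :=
    IsAlgClosure.equivOfEquiv_algebraMap (AlgebraicClosure K) (AlgebraicClosure K) _ a
  -- The first alternative always holds, with `s = 0` and hence trivial power of `x`: for `s > 0`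
  -- the sum for `f = x - 1 / 2` would not be an integer.
  refine Or.inl ⟨k, 0, σ, τ, hτ, fun f hf => ?_⟩
  obtain ⟨h, hm, hh⟩ := MonicRatio.exists_map_eq_prod_pow σ.toRingEquiv τ hτ k f
  refine ⟨0, h, by simp, hh, ?_⟩
  rw [MonicRatio.eq_ofPoly_of_forall_powerSumHom σ.toRingEquiv τ hτ hf hm hh
    fun n => h₀ n (MonicRatio.ofPoly f hf)]
  simp [MonicRatio.ofPoly, MonicRatio.mkRatio]
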